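/- Let $\lambda_1,\lambda_2,\lambda_3,\mu_1,\mu_2,\mu_3\in\mathbb{C}$ with $\sum\lambda_i=\sum\mu_i$, and put $$\theta_1=\lambda_1-\mu_1,\quad \theta_2=\lambda_2-\mu_1,\quad \theta_3=\lambda_3-\mu_1,\quad \theta_4=\mu_3-\mu_2 .$$ Let $U\subset\mathbb{C}\setminus\{0,1\}$ be open and let $y$ be a holomorphic function on $U$, with $y(t)\notin\{0,1,t\}$ for all $t\in U$, which solves the Painlevé VI equation $$y''=\tfrac12\Bigl(\tfrac1y+\tfrac1{y-1}+\tfrac1{y-t}\Bigr)(y')^2-\Bigl(\tfrac1t+\tfrac1{t-1}+\tfrac1{y-t}\Bigr)y'+\tfrac{y(y-1)(y-t)}{t^2(t-1)^2}\Bigl(\alpha+\beta\tfrac{t}{y^2}+\gamma\tfrac{t-1}{(y-1)^2}+\delta\tfrac{t(t-1)}{(y-t)^2}\Bigr)$$ with $\alpha=(\theta_4-1)^2/2$, $\beta=-\theta_1^2/2$, $\gamma=\theta_3^2/2$, $\delta=(1-\theta_2^2)/2$. Define $$x=\frac12\left(\frac{(t-1)y'-\theta_1}{y}+\frac{y'-1-\theta_2}{y-t}-\frac{t\,y'+\theta_3}{y-1}\right)$$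 and $$B_1=\begin{pmatrix}\lambda_1&b_{12}&b_{13}\\0&0&0\\0&0&0\end{pmatrix},\quad B_2=\begin{pmatrix}0&0&0\\b_{21}&\lambda_2&b_{23}\\0&0&0\end{pmatrix},\quad B_3=\begin{pmatrix}0&0&0\\0&0&0\\b_{31}&b_{32}&\lambda_3\end{pmatrix},$$ where $$b_{12}=\lambda_1-\mu_3y+(\mu_1-xy)(y-1),\qquad b_{13}=\lambda_1t-\mu_3y+(\mu_1-xy)(y-t),$$ $$b_{21}=\lambda_2+\frac{\mu_3(y-t)-\mu_1(y-1)+x(y-t)(y-1)}{t-1},$$ $$b_{32}=(\mu_2-\lambda_2-b_{12})/t,\qquad b_{23}=(\mu_2-\lambda_3)t-b_{13},\qquad b_{31}=(\mu_2-\lambda_1-b_{21})/t .$$ Then for every $t\in U$ the matrix $B_i(t)$ has trace $\lambda_i$ and rank at most one, and it has rank exactly one if $\lambda_i\neq0$ or $\mu_3\neq0$; the sum $B_1+B_2+B_3$ has eigenvalues $\mu_1,\mu_2,\mu_3$ (with multiplicity). Moreover the family of logarithmic connections $$\nabla_t=d-\left(\frac{B_1(t)}{z}+\frac{B_2(t)}{z-t}+\frac{B_3(t)}{z-1}\right)dz,\qquad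 t\in U,$$ on the trivial rank three bundle over $\mathbb{P}^1$ is isomonodromic: for every open disc $V\subset U$, all $t,t'\in V$ and every base point $z_0\in\mathbb{C}\setminus(V\cup\{0,1\})$ there is $C\in\mathrm{GL}_3(\mathbb{C})$ such that, for every loop $\gamma$ in $\mathbb{C}\setminus(V\cup\{0,1\})$ based at $z_0$, the monodromy matrices $M_\gamma(t)$ and $M_\gamma(t')$ of $\nabla_t$ and $\nabla_{t'}$ along $\gamma$ satisfy $M_\gamma(t')=C\,M_\gamma(t)\,C^{-1}$. (Here $M_\gamma(t)$ is the value at the end of $\gamma$ of the analytic continuation along $\gamma$ of the matrix solution $\Phi$ of $\nabla_t\Phi=0$ with $\Phi(z_0)=1$.) -/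

import Mathlib

/-!
In terms of `x` and `y` the sixth Painlevé equation is a Hamiltonian system. Along its solutions
the matrix `b = B₁ + B₂ + B₃`, whose rows are the nonzero rows of the residues, satisfies a Lax
equation `b' = [K, b]` with `K` explicit in `b` and `t`. For the residues these are the Schlesinger
equations up to the gauge `K`, which say that the connection
`d - A dz - (K - B₂ / (z - t)) dt`, `A = B₁ / z + B₂ / (z - t) + B₃ / (z - 1)`, is flat. Parallel
transport in the direction of `t` is therefore a gauge transformation `C(z)` between the
restrictions of this connection to two values of `t`, holomorphic and invertible wherever
`z ∉ V ∪ {0, 1}`. Continuing `C(z) Φ(z) C(z₀)⁻¹` along a loop, on which `C` is single valued,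
shows that `C(z₀)` conjugates all the monodromies at once.
-/

open Topology

noncomputable section

/-- `y` is a holomorphic solution, on the set `U`, of the sixth Painlevé equation with parameters
`θ = (θ₁, θ₂, θ₃, θ₄)`, that is with constants `α = (θ₄ - 1)² / 2`, `β = -θ₁² / 2`, `γ = θ₃² / 2`,
`δ = (1 - θ₂²) / 2`. The equation has denominators `y`, `y - 1`, `y - t`, which are required not
to vanish on `U`; `U` is meant to be an open subset of `ℂ \ {0, 1}`. -/
def SolvesPVI (θ : Fin 4 → ℂ) (U : Set ℂ) (y : ℂ → ℂ) : Prop :=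
  DifferentiableOn ℂ y U ∧
  ∀ t ∈ U, y t ≠ 0 ∧ y t ≠ 1 ∧ y t ≠ t ∧
    deriv (deriv y) t =
      1 / 2 * (1 / y t + 1 / (y t - 1) + 1 / (y t - t)) * deriv y t ^ 2
      - (1 / t + 1 / (t - 1) + 1 / (y t - t)) * deriv y t
      + y t * (y t - 1) * (y t - t) / (t ^ 2 * (t - 1) ^ 2) *
        ((θ 3 - 1) ^ 2 / 2
          + -(θ 0 ^ 2) / 2 * (t / y t ^ 2)
          + θ 2 ^ 2 / 2 * ((t - 1) / (y t - 1) ^ 2)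
          + (1 - θ 1 ^ 2) / 2 * (t * (t - 1) / (y t - t) ^ 2))

/-- `Y` is the analytic continuation along the path `γ` of a holomorphic matrix solution of
`dΦ/dz = A Φ`: near each parameter `s`, `Y` is the restriction to `γ` of a local solution. -/
def IsContinuation (A : ℂ → Matrix (Fin 3) (Fin 3) ℂ) {z₀ z₁ : ℂ} (γ : Path z₀ z₁)
    (Y : unitInterval → Matrix (Fin 3) (Fin 3) ℂ) : Prop :=
  ∀ s : unitInterval, ∃ Φ : ℂ → Matrix (Fin 3) (Fin 3) ℂ,
    (∀ᶠ z in 𝓝 (γ s), ∀ i j, HasDerivAt (fun w => Φ w i j) ((A z * Φ z) i j) z) ∧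
    ∀ᶠ s' in 𝓝 s, Y s' = Φ (γ s')

/-- `M` is the monodromy matrix along the loop `γ` of the connection `d - A dz`: the fundamental
solution that is the identity at the base point is continued along `γ` to the value `M`. -/
def IsMonodromy (A : ℂ → Matrix (Fin 3) (Fin 3) ℂ) {z₀ : ℂ} (γ : Path z₀ z₀)
    (M : Matrix (Fin 3) (Fin 3) ℂ) : Prop :=
  ∃ Y : unitInterval → Matrix (Fin 3) (Fin 3) ℂ, IsContinuation A γ Y ∧ Y 0 = 1 ∧ Y 1 = M

/-- The matrix `A = B₁ / z + B₂ / (z - t) + B₃ / (z - 1)` of the logarithmic connection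
`d - A dz` with poles `0, t, 1` (and `∞`). -/
def logMatrix (B : Fin 3 → Matrix (Fin 3) (Fin 3) ℂ) (t z : ℂ) : Matrix (Fin 3) (Fin 3) ℂ :=
  (1 / z) • B 0 + (1 / (z - t)) • B 1 + (1 / (z - 1)) • B 2

/-- The family of connections `d - (B₁(t) / z + B₂(t) / (z - t) + B₃(t) / (z - 1)) dz`, `t ∈ U`,
is isomonodromic: the conjugacy class of the monodromy representation is locally constant in `t`.
While `t` stays in a disc `V ⊆ U`, the fundamental groups of the punctured spheres are
identified by using the same loops, namely loops that avoid `V` and the fixed poles `0, 1`.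
One matrix `C` has to conjugate the monodromies along all these loops simultaneously. -/
def IsIsomonodromic (U : Set ℂ) (B : ℂ → Fin 3 → Matrix (Fin 3) (Fin 3) ℂ) : Prop :=
  ∀ (c : ℂ) (r : ℝ), Metric.ball c r ⊆ U →
    ∀ t ∈ Metric.ball c r, ∀ t' ∈ Metric.ball c r, ∀ z₀ : ℂ,
      ∃ C : GL (Fin 3) ℂ, ∀ γ : Path z₀ z₀,
        (∀ s, γ s ∉ Metric.ball c r ∧ γ s ≠ 0 ∧ γ s ≠ 1) →
        ∃ M : Matrix (Fin 3) (Fin 3) ℂ,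
          IsMonodromy (logMatrix (B t) t) γ M ∧
          IsMonodromy (logMatrix (B t') t') γ
            ((C : Matrix (Fin 3) (Fin 3) ℂ) * M * ((C⁻¹ : GL (Fin 3) ℂ) : Matrix _ _ ℂ))

/-- `θ₁ = λ₁ - μ₁`, `θ₂ = λ₂ - μ₁`, `θ₃ = λ₃ - μ₁`, `θ₄ = μ₃ - μ₂` (indices shifted by one). -/
def pviParam (lam mu : Fin 3 → ℂ) : Fin 4 → ℂ :=
  ![lam 0 - mu 0, lam 1 - mu 0, lam 2 - mu 0, mu 2 - mu 1]

/-- The function `x(t)` attached to `y(t)`. -/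
def xOf (θ : Fin 4 → ℂ) (y : ℂ → ℂ) (t : ℂ) : ℂ :=
  1 / 2 * (((t - 1) * deriv y t - θ 0) / y t + (deriv y t - 1 - θ 1) / (y t - t)
    - (t * deriv y t + θ 2) / (y t - 1))

/-- The residues `B₁, B₂, B₃` as functions of the numbers `x, y, t` and of `λ, μ`. -/
def residues (lam mu : Fin 3 → ℂ) (x y t : ℂ) : Fin 3 → Matrix (Fin 3) (Fin 3) ℂ :=
  let b₁₂ := lam 0 - mu 2 * y + (mu 0 - x * y) * (y - 1)
  let b₁₃ := lam 0 * t - mu 2 * y + (mu 0 - x * y) * (y - t)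
  let b₂₁ := lam 1 + (mu 2 * (y - t) - mu 0 * (y - 1) + x * (y - t) * (y - 1)) / (t - 1)
  let b₃₂ := (mu 1 - lam 1 - b₁₂) / t
  let b₂₃ := (mu 1 - lam 2) * t - b₁₃
  let b₃₁ := (mu 1 - lam 0 - b₂₁) / t
  ![!![lam 0, b₁₂, b₁₃; 0, 0, 0; 0, 0, 0],
    !![0, 0, 0; b₂₁, lam 1, b₂₃; 0, 0, 0],
    !![0, 0, 0; 0, 0, 0; b₃₁, b₃₂, lam 2]]

/-- The family of residues attached to a function `y(t)`. -/
def residueFamily (lam mu : Fin 3 → ℂ) (y : ℂ → ℂ) (t : ℂ) :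
    Fin 3 → Matrix (Fin 3) (Fin 3) ℂ :=
  residues lam mu (xOf (pviParam lam mu) y t) (y t) t

end

section LinearODE

open Complex Metric Set

variable {E : Type*} [NormedAddCommGroup E] [NormedSpace ℂ E] {c z : ℂ} {r : ℝ}

theorem hasDerivAt_comp_lineMap {u : ℂ → E} {u' : E} {s : ℝ}
    (h : HasDerivAt u u' (AffineMap.lineMap c z s)) :
    HasDerivAt (fun s : ℝ => u (AffineMap.lineMap c z s)) ((z - c) • u') s :=
  h.scomp s AffineMap.hasDerivAt_lineMap

theorem norm_le_mul_pow_div_of_hasDerivAt {u u' : ℂ → E} {K : ℝ} {n : ℕ}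
    (hu : ∀ w ∈ segment ℝ c z, HasDerivAt u (u' w) w) (h0 : u c = 0)
    (hb : ∀ w ∈ segment ℝ c z, ‖u' w‖ ≤ K * ‖w - c‖ ^ n) :
    ‖u z‖ ≤ K * ‖z - c‖ ^ (n + 1) / (n + 1) := by
  have hmem : ∀ s ∈ Icc (0 : ℝ) 1, AffineMap.lineMap c z s ∈ segment ℝ c z := fun s hs =>
    segment_eq_image_lineMap ℝ c z ▸ mem_image_of_mem _ hs
  have hd := fun s hs => hasDerivAt_comp_lineMap (hu _ (hmem s hs))
  have hB : ∀ s : ℝ, HasDerivAt (fun s : ℝ => K * ‖z - c‖ ^ (n + 1) / (n + 1) * s ^ (n + 1))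
      (K * ‖z - c‖ ^ (n + 1) * s ^ n) s := fun s => by
    refine ((hasDerivAt_pow (n + 1) s).const_mul _).congr_deriv ?_
    push_cast
    field_simp
  have key := image_norm_le_of_norm_deriv_right_le_deriv_boundary (a := 0) (b := 1)
    (fun s hs => (hd s hs).continuousAt.continuousWithinAt)
    (fun s hs => (hd s (Ico_subset_Icc_self hs)).hasDerivWithinAt)
    (by simp [h0]) hB (fun s hs => ?_) (right_mem_Icc.2 zero_le_one)
  · simpa using key
  · have h := hb _ (hmem s (Ico_subset_Icc_self hs))
    have hlin : ‖AffineMap.lineMap c z s - c‖ = s * ‖z - c‖ := by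
      rw [← dist_eq_norm, dist_lineMap_left, Real.norm_of_nonneg hs.1, dist_comm, dist_eq_norm]
    rw [hlin] at h
    calc ‖(z - c) • u' (AffineMap.lineMap c z s)‖
        ≤ ‖z - c‖ * (K * (s * ‖z - c‖) ^ n) := by rw [norm_smul]; gcongr
      _ = K * ‖z - c‖ ^ (n + 1) * s ^ n := by ring

theorem norm_le_gronwallBound_of_hasDerivAt {u u' : ℂ → E} {δ K ε : ℝ}
    (hu : ∀ w ∈ segment ℝ c z, HasDerivAt u (u' w) w) (hδ : ‖u c‖ ≤ δ)
    (hb : ∀ w ∈ segment ℝ c z, ‖u' w‖ ≤ K * ‖u w‖ + ε) :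
    ‖u z‖ ≤ gronwallBound δ (K * ‖z - c‖) (ε * ‖z - c‖) 1 := by
  have hmem : ∀ s ∈ Icc (0 : ℝ) 1, AffineMap.lineMap c z s ∈ segment ℝ c z := fun s hs =>
    segment_eq_image_lineMap ℝ c z ▸ mem_image_of_mem _ hs
  have hd := fun s hs => hasDerivAt_comp_lineMap (hu _ (hmem s hs))
  have key := norm_le_gronwallBound_of_norm_deriv_right_le (a := 0) (b := 1)
    (K := K * ‖z - c‖) (ε := ε * ‖z - c‖)
    (fun s hs => (hd s hs).continuousAt.continuousWithinAt)
    (fun s hs => (hd s (Ico_subset_Icc_self hs)).hasDerivWithinAt) (by simpa using hδ)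
    (fun s hs => ?_) 1 (right_mem_Icc.2 zero_le_one)
  · simpa using key
  · calc ‖(z - c) • u' (AffineMap.lineMap c z s)‖
        ≤ ‖z - c‖ * (K * ‖u (AffineMap.lineMap c z s)‖ + ε) := by
          rw [norm_smul]
          gcongr
          exact hb _ (hmem s (Ico_subset_Icc_self hs))
      _ = K * ‖z - c‖ * ‖u (AffineMap.lineMap c z s)‖ + ε * ‖z - c‖ := by ring

theorem isCompact_segment {F : Type*} [AddCommGroup F] [Module ℝ F] [TopologicalSpace F]
    [IsTopologicalAddGroup F] [ContinuousSMul ℝ F] (x y : F) : IsCompact (segment ℝ x y) := by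
  rw [segment_eq_image_lineMap]
  exact isCompact_Icc.image AffineMap.lineMap_continuous

theorem eq_of_linearODE {L : ℂ → E →L[ℂ] E} (hL : ContinuousOn L (segment ℝ c z)) {u v : ℂ → E}
    (hu : ∀ w ∈ segment ℝ c z, HasDerivAt u (L w (u w)) w)
    (hv : ∀ w ∈ segment ℝ c z, HasDerivAt v (L w (v w)) w) (h : u c = v c) : u z = v z := by
  obtain ⟨K, hK⟩ := (isCompact_segment c z).exists_bound_of_continuousOn hL
  have key := norm_le_gronwallBound_of_hasDerivAt (u := u - v) (δ := 0) (K := K) (ε := 0)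
    (fun w hw => (hu w hw).sub (hv w hw)) (by simp [h]) fun w hw => by
      rw [← map_sub, add_zero]
      exact (L w).le_of_opNorm_le (hK w hw) _
  rwa [zero_mul, gronwallBound_ε0_δ0, norm_le_zero_iff, Pi.sub_apply, sub_eq_zero] at key

/-- The `n`-th term of the Picard series solving `u' = L u`, `u c = v`. Its terms are iterated
integrals along the path from `c` that is first horizontal, then vertical. -/
noncomputable def picardTerm (L : ℂ → E →L[ℂ] E) (c : ℂ) (v : E) : ℕ → ℂ → E
  | 0 => fun _ => v
  | n + 1 => fun z => wedgeIntegral c z fun w => L w (picardTerm L c v n w)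

theorem picardTerm_succ_self (L : ℂ → E →L[ℂ] E) (c : ℂ) (v : E) (n : ℕ) :
    picardTerm L c v (n + 1) c = 0 := by
  simp [picardTerm, wedgeIntegral]

variable [CompleteSpace E] {L : ℂ → E →L[ℂ] E}

theorem differentiableOn_picardTerm (hL : DifferentiableOn ℂ L (ball c r)) (v : E) (n : ℕ) :
    DifferentiableOn ℂ (picardTerm L c v n) (ball c r) := by
  induction n with
  | zero => exact differentiableOn_const v
  | succ n ih =>
    have h := hL.clm_apply ih
    exact fun z hz => (h.isConservativeOn.hasDerivAt_wedgeIntegral h.continuousOn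
      hz).differentiableAt.differentiableWithinAt

theorem hasDerivAt_picardTerm_succ (hL : DifferentiableOn ℂ L (ball c r)) (v : E) (n : ℕ)
    (hz : z ∈ ball c r) :
    HasDerivAt (picardTerm L c v (n + 1)) (L z (picardTerm L c v n z)) z := by
  have h := hL.clm_apply (differentiableOn_picardTerm hL v n)
  exact h.isConservativeOn.hasDerivAt_wedgeIntegral h.continuousOn hz

theorem norm_picardTerm_le (hL : DifferentiableOn ℂ L (ball c r)) {K : ℝ}
    (hK : ∀ z ∈ ball c r, ‖L z‖ ≤ K) (v : E) (n : ℕ) (hz : z ∈ ball c r) :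
    ‖picardTerm L c v n z‖ ≤ ‖v‖ * ((K * ‖z - c‖) ^ n / n.factorial) := by
  induction n generalizing z with
  | zero => simp [picardTerm]
  | succ n ih =>
    have hcz : segment ℝ c z ⊆ ball c r :=
      (convex_ball c r).segment_subset (mem_ball_self (pos_of_mem_ball hz)) hz
    refine (norm_le_mul_pow_div_of_hasDerivAt (K := K * ‖v‖ * K ^ n / n.factorial) (n := n)
      (fun w hw => hasDerivAt_picardTerm_succ hL v n (hcz hw)) (picardTerm_succ_self L c v n)
      fun w hw => ?_).trans_eq ?_
    · calc ‖L w (picardTerm L c v n w)‖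
          ≤ K * (‖v‖ * ((K * ‖w - c‖) ^ n / n.factorial)) :=
            (L w).le_of_opNorm_le_of_le (hK w (hcz hw)) (ih (hcz hw))
        _ = K * ‖v‖ * K ^ n / n.factorial * ‖w - c‖ ^ n := by ring
    · rw [Nat.factorial_succ]
      push_cast
      field_simp
      ring

theorem hasDerivAt_tsum_picardTerm (hL : DifferentiableOn ℂ L (ball c r)) (v : E)
    (hz : z ∈ ball c r) :
    HasDerivAt (fun w => v + ∑' n, picardTerm L c v (n + 1) w)
      (L z (v + ∑' n, picardTerm L c v (n + 1) z)) z := by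
  obtain ⟨ρ, hzρ, hρr⟩ := exists_between (mem_ball.1 hz)
  obtain ⟨K, hK⟩ := (isCompact_closedBall c ρ).exists_bound_of_continuousOn
    (hL.continuousOn.mono (closedBall_subset_ball hρr))
  replace hK : ∀ w ∈ ball c ρ, ‖L w‖ ≤ K := fun w hw => hK w (ball_subset_closedBall hw)
  have hK0 : 0 ≤ K := (norm_nonneg _).trans (hK z hzρ)
  have hLρ := hL.mono (ball_subset_ball hρr.le)
  have hsum : Summable fun n : ℕ => ‖v‖ * ((K * ρ) ^ n / n.factorial) :=
    (Real.summable_pow_div_factorial (K * ρ)).mul_left _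
  have hbound : ∀ n, ∀ w ∈ ball c ρ,
      ‖picardTerm L c v n w‖ ≤ ‖v‖ * ((K * ρ) ^ n / n.factorial) := fun n w hw =>
    (norm_picardTerm_le hLρ hK v n hw).trans (by gcongr; exact (mem_ball_iff_norm.1 hw).le)
  have hz_sum : Summable fun n => picardTerm L c v n z :=
    hsum.of_norm_bounded fun n => hbound n z hzρ
  have hder := hasDerivAt_tsum_of_isPreconnected (hsum.mul_left K) isOpen_ball
    (convex_ball c ρ).isPreconnected (fun n w hw => hasDerivAt_picardTerm_succ hLρ v n hw)
    (fun n w hw => (L w).le_of_opNorm_le_of_le (hK w hw) (hbound n w hw))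
    (mem_ball_self (pos_of_mem_ball hzρ))
    (by simpa only [picardTerm_succ_self] using summable_zero) hzρ
  refine (hder.const_add v).congr_deriv ?_
  rw [← (L z).map_tsum hz_sum, hz_sum.tsum_eq_zero_add]
  rfl

theorem exists_linearODE_solution_center (hL : DifferentiableOn ℂ L (ball c r)) (v : E) :
    ∃ u : ℂ → E, u c = v ∧ ∀ z ∈ ball c r, HasDerivAt u (L z (u z)) z :=
  ⟨fun z => v + ∑' n, picardTerm L c v (n + 1) z, by simp [picardTerm_succ_self],
    fun _ hz => hasDerivAt_tsum_picardTerm hL v hz⟩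

variable {R : Type*} [NormedRing R] [NormedAlgebra ℂ R] [CompleteSpace R] {f : ℂ → R}

theorem exists_fundamentalSolution (hf : DifferentiableOn ℂ f (ball c r)) :
    ∃ Φ : ℂ → R, Φ c = 1 ∧ ∀ z ∈ ball c r, IsUnit (Φ z) ∧ HasDerivAt Φ (f z * Φ z) z := by
  let l := ContinuousLinearMap.mul ℂ R
  have hl : DifferentiableOn ℂ (fun z => l (f z)) (ball c r) :=
    l.differentiable.comp_differentiableOn hf
  have hr : DifferentiableOn ℂ (fun z => l.flip (f z)) (ball c r) :=
    l.flip.differentiable.comp_differentiableOn hf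
  obtain ⟨Φ, hΦc, hΦ⟩ := exists_linearODE_solution_center hl 1
  obtain ⟨Ψ, hΨc, hΨ⟩ := exists_linearODE_solution_center hr.neg 1
  refine ⟨Φ, hΦc, fun z hz => ⟨?_, hΦ z hz⟩⟩
  have hcz : segment ℝ c z ⊆ ball c r :=
    (convex_ball c r).segment_subset (mem_ball_self (pos_of_mem_ball hz)) hz
  have hΨΦ : (Ψ * Φ) z = 1 :=
    eq_of_linearODE (L := fun _ => 0) (v := fun _ => 1) continuousOn_const
      (fun w hw => ((hΨ w (hcz hw)).mul (hΦ w (hcz hw))).congr_deriv (by simp [l, mul_assoc]))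
      (fun w _ => hasDerivAt_const w 1) (by simp [hΦc, hΨc])
  have hΦΨ : (Φ * Ψ) z = 1 :=
    eq_of_linearODE (L := fun w => l (f w) - l.flip (f w)) (v := fun _ => 1)
      ((hl.sub hr).continuousOn.mono hcz)
      (fun w hw => ((hΦ w (hcz hw)).mul (hΨ w (hcz hw))).congr_deriv
        (by simp [l, mul_assoc, sub_eq_add_neg]))
      (fun w _ => (hasDerivAt_const w 1).congr_deriv (by simp [l])) (by simp [hΦc, hΨc])
  exact ⟨⟨Φ z, Ψ z, hΦΨ, hΨΦ⟩, rfl⟩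

theorem exists_linearODE_solution (hf : DifferentiableOn ℂ f (ball c r)) (hz : z ∈ ball c r)
    (y : R) : ∃ Φ : ℂ → R, Φ z = y ∧ ∀ w ∈ ball c r, HasDerivAt Φ (f w * Φ w) w := by
  obtain ⟨Φ, -, hΦ⟩ := exists_fundamentalSolution hf
  obtain ⟨u, hu⟩ := (hΦ z hz).1
  refine ⟨fun w => Φ w * (↑u⁻¹ * y), by simp [← hu], fun w hw => ?_⟩
  exact ((hΦ w hw).2.mul_const _).congr_deriv (mul_assoc _ _ _)

end LinearODE

section ParameterDependence

open Filter Metric Set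

variable {E : Type*} [NormedAddCommGroup E] [NormedSpace ℂ E]

theorem norm_dslope_le_of_norm_le {f : ℂ → E} {c z : ℂ} {r M : ℝ}
    (hf : DifferentiableOn ℂ f (ball c r)) (hM : ∀ w ∈ ball c r, ‖f w‖ ≤ M)
    (hz : z ∈ ball c r) : ‖dslope f c z‖ ≤ (M + M) / r := by
  refine Complex.norm_dslope_le_div_of_mapsTo_ball hf (fun w hw => ?_) hz
  rw [mem_closedBall, dist_eq_norm]
  exact norm_sub_le_of_le (hM w hw) (hM c (mem_ball_self (pos_of_mem_ball hz)))

variable [CompleteSpace E] {Ω : ℂ → ℂ → E →L[ℂ] E} {C : ℂ → ℂ → E} {v : ℂ → E} {z₀ c τ : ℂ}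
  {ρ M : ℝ}

/-- `v` solves the linearised equation, so the difference quotient `slope (C · τ) z₀ z` solves the
same equation up to an error of order `z - z₀`, which Grönwall's inequality controls. -/
theorem norm_slope_sub_le_gronwallBound
    (hΩ : ∀ s ∈ segment ℝ c τ, DifferentiableOn ℂ (Ω · s) (ball z₀ ρ))
    (hM : ∀ z ∈ ball z₀ ρ, ∀ s ∈ segment ℝ c τ, ‖Ω z s‖ ≤ M)
    (hC : ∀ z ∈ ball z₀ ρ, ∀ s ∈ segment ℝ c τ, HasDerivAt (C z) (Ω z s (C z s)) s)
    (hCc : ∀ z ∈ ball z₀ ρ, C z c = C z₀ c)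
    (hv : ∀ s ∈ segment ℝ c τ, HasDerivAt v (Ω z₀ s (v s) + deriv (Ω · s) z₀ (C z₀ s)) s)
    (hvc : v c = 0) {b₀ b₁ : ℝ} (hb₀ : ∀ s ∈ segment ℝ c τ, ‖C z₀ s‖ ≤ b₀)
    (hb₁ : ∀ s ∈ segment ℝ c τ, ‖v s‖ ≤ b₁) {z : ℂ} (hz : z ∈ ball z₀ ρ) (hne : z ≠ z₀) :
    ‖slope (C · τ) z₀ z - v τ‖ ≤
      gronwallBound 0 (M * ‖τ - c‖) (‖z - z₀‖ * ((M + M) / ρ * b₁ +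
        ((M + M) / ρ + (M + M) / ρ) / ρ * b₀) * ‖τ - c‖) 1 := by
  have hz₀ : z₀ ∈ ball z₀ ρ := mem_ball_self (pos_of_mem_ball hz)
  have hzz₀ : z - z₀ ≠ 0 := sub_ne_zero.2 hne
  let G : ℂ → ℂ → E →L[ℂ] E := fun s => dslope (Ω · s) z₀
  let H : ℂ → ℂ → E →L[ℂ] E := fun s => dslope (G s) z₀
  have hG : ∀ s ∈ segment ℝ c τ, ∀ w ∈ ball z₀ ρ, ‖G s w‖ ≤ (M + M) / ρ := fun s hs w hw =>
    norm_dslope_le_of_norm_le (hΩ s hs) (fun w hw => hM w hw s hs) hw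
  have hH : ∀ s ∈ segment ℝ c τ, ‖H s z‖ ≤ ((M + M) / ρ + (M + M) / ρ) / ρ := fun s hs =>
    norm_dslope_le_of_norm_le ((Complex.differentiableOn_dslope (ball_mem_nhds z₀
      (pos_of_mem_ball hz))).2 (hΩ s hs)) (hG s hs) hz
  refine norm_le_gronwallBound_of_hasDerivAt (u := fun s => slope (C · s) z₀ z - v s)
    (u' := fun s => Ω z s (slope (C · s) z₀ z - v s) +
      (z - z₀) • (G s z (v s) + H s z (C z₀ s)))
    (fun s hs => ?_) (by simp [slope_def_module, hCc z hz, hvc]) fun s hs => ?_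
  · refine ((((hC z hz s hs).sub (hC z₀ hz₀ s hs)).const_smul (z - z₀)⁻¹).sub
      (hv s hs)).congr_deriv ?_
    have eG : Ω z s = Ω z₀ s + (z - z₀) • G s z := by simp [G, sub_smul_dslope]
    have eH : G s z = deriv (Ω · s) z₀ + (z - z₀) • H s z := by
      rw [← dslope_same (Ω · s) z₀]
      simp [H, G, sub_smul_dslope]
    rw [eG, eH]
    simp only [slope_def_module, map_sub, map_smul, add_apply, smul_apply]
    match_scalars <;> field_simp <;> ring
  · refine (norm_add_le _ _).trans (add_le_add ((Ω z s).le_of_opNorm_le (hM z hz s hs) _) ?_)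
    rw [norm_smul]
    gcongr
    exact norm_add_le_of_le ((G s z).le_of_opNorm_le_of_le (hG s hs z hz) (hb₁ s hs))
      ((H s z).le_of_opNorm_le_of_le (hH s hs) (hb₀ s hs))

theorem hasDerivAt_parameter (hρ : 0 < ρ)
    (hΩ : ∀ s ∈ segment ℝ c τ, DifferentiableOn ℂ (Ω · s) (ball z₀ ρ))
    (hM : ∀ z ∈ ball z₀ ρ, ∀ s ∈ segment ℝ c τ, ‖Ω z s‖ ≤ M)
    (hC : ∀ z ∈ ball z₀ ρ, ∀ s ∈ segment ℝ c τ, HasDerivAt (C z) (Ω z s (C z s)) s)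
    (hCc : ∀ z ∈ ball z₀ ρ, C z c = C z₀ c)
    (hv : ∀ s ∈ segment ℝ c τ, HasDerivAt v (Ω z₀ s (v s) + deriv (Ω · s) z₀ (C z₀ s)) s)
    (hvc : v c = 0) : HasDerivAt (C · τ) (v τ) z₀ := by
  obtain ⟨b₀, hb₀⟩ := (isCompact_segment c τ).exists_bound_of_continuousOn
    fun s hs => (hC z₀ (mem_ball_self hρ) s hs).continuousAt.continuousWithinAt
  obtain ⟨b₁, hb₁⟩ := (isCompact_segment c τ).exists_bound_of_continuousOn
    fun s hs => (hv s hs).continuousAt.continuousWithinAt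
  rw [hasDerivAt_iff_tendsto_slope, tendsto_iff_norm_sub_tendsto_zero]
  set N := (M + M) / ρ * b₁ + ((M + M) / ρ + (M + M) / ρ) / ρ * b₀
  have hlim : Tendsto (fun z => gronwallBound 0 (M * ‖τ - c‖) (‖z - z₀‖ * N * ‖τ - c‖) 1)
      (𝓝[≠] z₀) (𝓝 0) := by
    have hcont : Continuous fun z : ℂ => ‖z - z₀‖ * N * ‖τ - c‖ := by fun_prop
    simpa [Function.comp_def, gronwallBound_ε0_δ0] using
      ((gronwallBound_continuous_ε 0 (M * ‖τ - c‖) 1).comp hcont).continuousAt.tendsto.mono_left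
        (nhdsWithin_le_nhds (a := z₀) (s := {z₀}ᶜ))
  refine squeeze_zero' (.of_forall fun _ => norm_nonneg _) ?_ hlim
  filter_upwards [self_mem_nhdsWithin, mem_nhdsWithin_of_mem_nhds (ball_mem_nhds z₀ hρ)]
    with z hne hz
  exact norm_slope_sub_le_gronwallBound hΩ hM hC hCc hv hvc hb₀ hb₁ hz hne

end ParameterDependence

section Gauge

open Metric Set

variable {R : Type*} [NormedRing R] [NormedAlgebra ℂ R]

/-- The connections `d - A dz` and `d - A' dz` on `S` are related by a gauge transformation `C`,
which sends solutions `Φ` of `Φ' = A Φ` to solutions `C Φ` of `Φ' = A' Φ`. -/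
def GaugeEquivOn (S : Set ℂ) (A A' : ℂ → R) : Prop :=
  ∃ C : ℂ → R, ∀ z ∈ S, IsUnit (C z) ∧ HasDerivAt C (A' z * C z - C z * A z) z

variable {S : Set ℂ} {A A' A'' : ℂ → R}

theorem GaugeEquivOn.trans (h : GaugeEquivOn S A A') (h' : GaugeEquivOn S A' A'') :
    GaugeEquivOn S A A'' := by
  obtain ⟨C, hC⟩ := h
  obtain ⟨C', hC'⟩ := h'
  refine ⟨fun z => C' z * C z, fun z hz => ⟨(hC' z hz).1.mul (hC z hz).1, ?_⟩⟩
  refine ((hC' z hz).2.mul (hC z hz).2).congr_deriv ?_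
  noncomm_ring

variable [CompleteSpace R]

theorem GaugeEquivOn.symm (h : GaugeEquivOn S A A') : GaugeEquivOn S A' A := by
  obtain ⟨C, hC⟩ := h
  refine ⟨fun z => Ring.inverse (C z), fun z hz => ⟨(hC z hz).1.ringInverse, ?_⟩⟩
  obtain ⟨u, hu⟩ := (hC z hz).1
  have hinv := hasFDerivAt_ringInverse (𝕜 := ℂ) u
  rw [hu] at hinv
  refine (hinv.comp_hasDerivAt z (hC z hz).2).congr_deriv ?_
  simp [← hu, mul_sub, sub_mul, mul_assoc]

theorem gaugeEquivOn_center_of_zeroCurvature (hS : IsOpen S) {A Ω : ℂ → ℂ → R} {c τ : ℂ} {r : ℝ}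
    (hΩ : DifferentiableOn ℂ (Function.uncurry Ω) (S ×ˢ ball c r))
    (hA : ∀ z ∈ S, ∀ s ∈ ball c r, HasDerivAt (A z) (deriv (Ω · s) z + ⁅Ω z s, A z s⁆) s)
    (hτ : τ ∈ ball c r) : GaugeEquivOn S (A · c) (A · τ) := by
  have hΩ_snd : ∀ z ∈ S, DifferentiableOn ℂ (Ω z) (ball c r) := fun z hz =>
    hΩ.comp (f := fun s => (z, s)) (by fun_prop) fun s hs => ⟨hz, hs⟩
  have hΩ_fst : ∀ s ∈ ball c r, DifferentiableOn ℂ (Ω · s) S := fun s hs =>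
    hΩ.comp (f := fun z => (z, s)) (by fun_prop) fun z hz => ⟨hz, hs⟩
  choose! C hCc hC using fun z hz => exists_fundamentalSolution (hΩ_snd z hz)
  refine ⟨(C · τ), fun z₀ hz₀ => ⟨(hC z₀ hz₀ τ hτ).1, ?_⟩⟩
  have hcτ : segment ℝ c τ ⊆ ball c r :=
    (convex_ball c r).segment_subset (mem_ball_self (pos_of_mem_ball hτ)) hτ
  obtain ⟨ρ, hρ, hρS⟩ := nhds_basis_closedBall.mem_iff.1 (hS.mem_nhds hz₀)
  have hball : ball z₀ ρ ⊆ S := ball_subset_closedBall.trans hρS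
  obtain ⟨M, hM⟩ := ((isCompact_closedBall z₀ ρ).prod
    (isCompact_segment c τ)).exists_bound_of_continuousOn (hΩ.continuousOn.mono (prod_mono hρS hcτ))
  let l := ContinuousLinearMap.mul ℂ R
  refine hasDerivAt_parameter (Ω := fun z s => l (Ω z s)) (C := C)
    (v := fun s => A z₀ s * C z₀ s - C z₀ s * A z₀ c) hρ
    (fun s hs => l.differentiable.comp_differentiableOn ((hΩ_fst s (hcτ hs)).mono hball))
    (fun z hz s hs => (ContinuousLinearMap.opNorm_mul_apply_le ℂ R _).trans
      (hM (z, s) ⟨ball_subset_closedBall hz, hs⟩))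
    (fun z hz s hs => (hC z (hball hz) s (hcτ hs)).2)
    (fun z hz => by rw [hCc z (hball hz), hCc z₀ hz₀]) (fun s hs => ?_) (by simp [hCc z₀ hz₀])
  have hdC := (hC z₀ hz₀ s (hcτ hs)).2
  have hderiv : deriv (fun z => l (Ω z s)) z₀ = l (deriv (Ω · s) z₀) :=
    (l.hasFDerivAt.comp_hasDerivAt z₀ ((hΩ_fst s (hcτ hs)).differentiableAt
      (hS.mem_nhds hz₀)).hasDerivAt).deriv
  refine (((hA z₀ hz₀ s (hcτ hs)).mul hdC).sub (hdC.mul_const (A z₀ c))).congr_deriv ?_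
  rw [hderiv]
  simp only [l, ContinuousLinearMap.mul_apply', Ring.lie_def]
  noncomm_ring

/-- The zero-curvature equation `∂A/∂τ = ∂Ω/∂z + [Ω, A]` makes the connection
`d - A dz - Ω dτ` flat, so its parallel transport in the direction of `τ` is a gauge
transformation between its restrictions to two values of `τ`. -/
theorem gaugeEquivOn_of_zeroCurvature (hS : IsOpen S) {A Ω : ℂ → ℂ → R} {c τ τ' : ℂ} {r : ℝ}
    (hΩ : DifferentiableOn ℂ (Function.uncurry Ω) (S ×ˢ ball c r))
    (hA : ∀ z ∈ S, ∀ s ∈ ball c r, HasDerivAt (A z) (deriv (Ω · s) z + ⁅Ω z s, A z s⁆) s)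
    (hτ : τ ∈ ball c r) (hτ' : τ' ∈ ball c r) : GaugeEquivOn S (A · τ) (A · τ') :=
  (gaugeEquivOn_center_of_zeroCurvature hS hΩ hA hτ).symm.trans
    (gaugeEquivOn_center_of_zeroCurvature hS hΩ hA hτ')

end Gauge

section Continuation

open Metric Set Filter

variable {R : Type*} [NormedRing R] [NormedAlgebra ℂ R] {f : ℂ → R} {W : Set ℂ}

theorem eventuallyEq_of_linearODE (hW : IsOpen W) (hf : ContinuousOn f W) {p : ℂ} (hp : p ∈ W)
    {Φ Ψ : ℂ → R} (hΦ : ∀ᶠ z in 𝓝 p, HasDerivAt Φ (f z * Φ z) z)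
    (hΨ : ∀ᶠ z in 𝓝 p, HasDerivAt Ψ (f z * Ψ z) z) (h : Φ p = Ψ p) : Φ =ᶠ[𝓝 p] Ψ := by
  obtain ⟨ρ, hρ, hball⟩ :=
    eventually_nhds_iff_ball.1 ((hΦ.and hΨ).and (hW.mem_nhds hp))
  filter_upwards [ball_mem_nhds p hρ] with z hz
  have hseg : segment ℝ p z ⊆ ball p ρ := (convex_ball p ρ).segment_subset (mem_ball_self hρ) hz
  exact eq_of_linearODE (L := fun w => ContinuousLinearMap.mul ℂ R (f w))
    ((ContinuousLinearMap.mul ℂ R).continuous.comp_continuousOn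
      (hf.mono fun w hw => (hball w (hseg hw)).2))
    (fun w hw => (hball w (hseg hw)).1.1) (fun w hw => (hball w (hseg hw)).1.2) h

/-- `Y` is the continuation along the part `J` of the path `γ` of a solution of `Φ' = f Φ`; for
`J = univ` and matrices this is `IsContinuation`. -/
def IsContinuationOn (f : ℂ → R) (γ : unitInterval → ℂ) (J : Set unitInterval)
    (Y : unitInterval → R) : Prop :=
  ∀ s ∈ J, ∃ Φ : ℂ → R, (∀ᶠ z in 𝓝 (γ s), HasDerivAt Φ (f z * Φ z) z) ∧
    ∀ᶠ s' in 𝓝[J] s, Y s' = Φ (γ s')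

variable {γ : unitInterval → ℂ} {J J₁ J₂ : Set unitInterval} {Y Y' : unitInterval → R}

theorem IsContinuationOn.congr (h : IsContinuationOn f γ J Y) (hYY' : EqOn Y Y' J) :
    IsContinuationOn f γ J Y' := by
  intro s hs
  obtain ⟨Φ, hΦ, hY⟩ := h s hs
  refine ⟨Φ, hΦ, ?_⟩
  filter_upwards [hY, self_mem_nhdsWithin] with s' hs' hJ
  rw [← hYY' hJ, hs']

theorem IsContinuationOn.union (hW : IsOpen W) (hf : ContinuousOn f W) (hγ : Continuous γ)
    (hγW : ∀ s, γ s ∈ W) (hJ₁ : IsClosed J₁) (hJ₂ : IsClosed J₂)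
    (h₁ : IsContinuationOn f γ J₁ Y) (h₂ : IsContinuationOn f γ J₂ Y) :
    IsContinuationOn f γ (J₁ ∪ J₂) Y := by
  intro s hs
  have hnotMem : ∀ J : Set unitInterval, IsClosed J → s ∉ J → 𝓝[J] s = ⊥ := fun J hJ hsJ =>
    notMem_closure_iff_nhdsWithin_eq_bot.1 (hJ.closure_eq.symm ▸ hsJ)
  simp only [nhdsWithin_union, eventually_sup]
  by_cases hs₁ : s ∈ J₁
  · obtain ⟨Φ, hΦ, hYΦ⟩ := h₁ s hs₁
    refine ⟨Φ, hΦ, hYΦ, ?_⟩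
    by_cases hs₂ : s ∈ J₂
    · obtain ⟨Ψ, hΨ, hYΨ⟩ := h₂ s hs₂
      have hΦΨ : Φ =ᶠ[𝓝 (γ s)] Ψ := eventuallyEq_of_linearODE hW hf (hγW s) hΦ hΨ
        ((hYΦ.self_of_nhdsWithin hs₁).symm.trans (hYΨ.self_of_nhdsWithin hs₂))
      filter_upwards [hYΨ, nhdsWithin_le_nhds (hγ.continuousAt.eventually hΦΨ)] with s' hY hs'
      rw [hY, hs']
    · simp [hnotMem J₂ hJ₂ hs₂]
  · obtain ⟨Ψ, hΨ, hYΨ⟩ := h₂ s (hs.resolve_left hs₁)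
    exact ⟨Ψ, hΨ, by simp [hnotMem J₁ hJ₁ hs₁], hYΨ⟩

variable [CompleteSpace R]

theorem exists_isContinuationOn_Icc (hW : IsOpen W) (hf : DifferentiableOn ℂ f W)
    (hγ : Continuous γ) (hγW : ∀ s, γ s ∈ W) {a b : unitInterval} (hab : a ≤ b) {c : ℂ} {r : ℝ}
    (hcW : ball c r ⊆ W) (hball : Icc a b ⊆ γ ⁻¹' ball c r)
    (hY : IsContinuationOn f γ (Icc 0 a) Y) :
    ∃ Y', Y' 0 = Y 0 ∧ IsContinuationOn f γ (Icc 0 b) Y' := by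
  obtain ⟨Φ, hΦa, hΦ⟩ := exists_linearODE_solution (hf.mono hcW) (hball (left_mem_Icc.2 hab)) (Y a)
  refine ⟨(Icc 0 a).piecewise Y (Φ ∘ γ), piecewise_eq_of_mem _ _ _ (by simp), ?_⟩
  rw [← Icc_union_Icc_eq_Icc (show 0 ≤ a from a.2.1) hab]
  refine .union hW hf.continuousOn hγ hγW isClosed_Icc isClosed_Icc
    (hY.congr (piecewise_eqOn _ _ _).symm) (.congr (Y := Φ ∘ γ) (fun s hs => ⟨Φ, ?_, ?_⟩) ?_)
  · filter_upwards [isOpen_ball.mem_nhds (hball hs)] using hΦ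
  · exact .of_forall fun _ => rfl
  · intro s hs
    rcases hs.1.eq_or_lt with rfl | has
    · simp [piecewise, hΦa]
    · simp [piecewise, has.not_ge]

theorem exists_isContinuationOn_univ (hW : IsOpen W) (hf : DifferentiableOn ℂ f W)
    (hγ : Continuous γ) (hγW : ∀ s, γ s ∈ W) (y : R) :
    ∃ Y, Y 0 = y ∧ IsContinuationOn f γ univ Y := by
  obtain ⟨t, ht0, hmono, ⟨n, hn⟩, ht⟩ := exists_monotone_Icc_subset_open_cover_unitInterval
    (c := fun B : {B : ℂ × ℝ // ball B.1 B.2 ⊆ W} => γ ⁻¹' ball B.1.1 B.1.2)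
    (fun B => isOpen_ball.preimage hγ) fun s _ => by
      obtain ⟨ρ, hρ, hρW⟩ := isOpen_iff.1 hW (γ s) (hγW s)
      exact mem_iUnion.2 ⟨⟨(γ s, ρ), hρW⟩, mem_ball_self hρ⟩
  have hstep : ∀ n, ∃ Y, Y 0 = y ∧ IsContinuationOn f γ (Icc 0 (t n)) Y := fun n => by
    induction n with
    | zero =>
      obtain ⟨ρ, hρ, hρW⟩ := isOpen_iff.1 hW (γ 0) (hγW 0)
      obtain ⟨Φ, hΦ0, hΦ⟩ := exists_linearODE_solution (hf.mono hρW) (mem_ball_self hρ) y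
      refine ⟨Φ ∘ γ, hΦ0, fun s hs => ⟨Φ, ?_, .of_forall fun _ => rfl⟩⟩
      obtain rfl : s = 0 := by simpa [ht0] using hs
      filter_upwards [ball_mem_nhds (γ 0) hρ] using hΦ
    | succ n ih =>
      obtain ⟨Y, rfl, hY⟩ := ih
      obtain ⟨⟨B, hBW⟩, hB⟩ := ht n
      exact exists_isContinuationOn_Icc hW hf hγ hγW (hmono n.le_succ) hBW hB hY
  obtain ⟨Y, hY0, hY⟩ := hstep n
  rw [hn n le_rfl, show Icc (0 : unitInterval) 1 = univ from Icc_bot_top] at hY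
  exact ⟨Y, hY0, hY⟩

end Continuation

section MatrixContinuation

open scoped Matrix.Norms.Operator

variable {A A' : ℂ → Matrix (Fin 3) (Fin 3) ℂ} {z₀ z₁ : ℂ} {γ : Path z₀ z₁} {S : Set ℂ}
  {Y : unitInterval → Matrix (Fin 3) (Fin 3) ℂ}

theorem hasDerivAt_matrix_iff {m n : Type*} [Finite m] [Finite n] {Φ : ℂ → Matrix m n ℂ}
    {D : Matrix m n ℂ} {z : ℂ} :
    HasDerivAt Φ D z ↔ ∀ i j, HasDerivAt (fun w => Φ w i j) (D i j) z := by
  cases nonempty_fintype m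
  cases nonempty_fintype n
  exact hasDerivAt_pi.trans (forall_congr' fun _ => hasDerivAt_pi)

theorem isContinuation_iff_isContinuationOn_univ :
    IsContinuation A γ Y ↔ IsContinuationOn A γ Set.univ Y := by
  simp only [IsContinuation, IsContinuationOn, ← hasDerivAt_matrix_iff, nhdsWithin_univ,
    Set.mem_univ, forall_const]
  rfl

theorem exists_isContinuation (hS : IsOpen S) (hA : DifferentiableOn ℂ A S)
    (hγ : ∀ s, γ s ∈ S) : ∃ Y, Y 0 = 1 ∧ IsContinuation A γ Y := by
  simpa only [isContinuation_iff_isContinuationOn_univ] using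
    exists_isContinuationOn_univ hS hA γ.continuous hγ 1

theorem IsContinuation.gauge (hY : IsContinuation A γ Y) (hS : IsOpen S) (hγ : ∀ s, γ s ∈ S)
    {C : ℂ → Matrix (Fin 3) (Fin 3) ℂ}
    (hC : ∀ z ∈ S, HasDerivAt C (A' z * C z - C z * A z) z) (D : Matrix (Fin 3) (Fin 3) ℂ) :
    IsContinuation A' γ (fun s => C (γ s) * Y s * D) := by
  intro s
  obtain ⟨Φ, hΦ, hΦY⟩ := hY s
  refine ⟨fun z => C z * Φ z * D, ?_, hΦY.mono fun s' h => by simp only [h]⟩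
  filter_upwards [hΦ, hS.mem_nhds (hγ s)] with z hΦz hz
  refine hasDerivAt_matrix_iff.1
    (((hC z hz).mul (hasDerivAt_matrix_iff.2 hΦz)).mul_const D |>.congr_deriv ?_)
  noncomm_ring

theorem isMonodromy_conj (hS : IsOpen S) (hA : DifferentiableOn ℂ A S) {γ : Path z₀ z₀}
    (hγ : ∀ s, γ s ∈ S) {C : ℂ → Matrix (Fin 3) (Fin 3) ℂ}
    (hC : ∀ z ∈ S, HasDerivAt C (A' z * C z - C z * A z) z) {u : GL (Fin 3) ℂ} (hu : ↑u = C z₀) :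
    ∃ M, IsMonodromy A γ M ∧ IsMonodromy A' γ (u * M * (u⁻¹ : GL (Fin 3) ℂ)) := by
  obtain ⟨Y, hY0, hY⟩ := exists_isContinuation hS hA hγ
  exact ⟨Y 1, ⟨Y, hY, hY0, rfl⟩, _, hY.gauge hS hγ hC (u⁻¹ : GL (Fin 3) ℂ), by simp [hY0, ← hu],
    by simp [hu]⟩

end MatrixContinuation

section Schlesinger

open Metric Set
open scoped Matrix.Norms.Operator

/-- The right-hand side of the Schlesinger equations for the residues `B` at the poles `0, t, 1`,
up to the infinitesimal simultaneous conjugation `⁅K, B i⁆`, which the gauge `K` makes explicit. -/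
noncomputable def schlesingerField {R : Type*} [Ring R] [Module ℂ R] (B : Fin 3 → R) (K : R)
    (t : ℂ) : Fin 3 → R :=
  ![t⁻¹ • ⁅B 1, B 0⁆ + ⁅K, B 0⁆,
    t⁻¹ • ⁅B 0, B 1⁆ + (t - 1)⁻¹ • ⁅B 2, B 1⁆ + ⁅K, B 1⁆,
    (t - 1)⁻¹ • ⁅B 1, B 2⁆ + ⁅K, B 2⁆]

/-- The `dt`-component `K - B₂ / (z - t)` of the flat connection whose `dz`-component is
`logMatrix`. -/
noncomputable def deformationMatrix {R : Type*} [Ring R] [Module ℂ R] (B : Fin 3 → R) (K : R)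
    (t z : ℂ) : R :=
  K - (z - t)⁻¹ • B 1

theorem hasDerivAt_deformationMatrix {R : Type*} [NormedRing R] [NormedAlgebra ℂ R]
    (B : Fin 3 → R) (K : R) {t z : ℂ} (hzt : z ≠ t) :
    HasDerivAt (deformationMatrix B K t) (((z - t) ^ 2)⁻¹ • B 1) z := by
  refine ((((hasDerivAt_id' z).sub_const t).fun_inv (sub_ne_zero.2 hzt)).smul_const
    (B 1) |>.const_sub K).congr_deriv ?_
  rw [neg_div, neg_smul, neg_neg, one_div]

theorem differentiableOn_logMatrix (B : Fin 3 → Matrix (Fin 3) (Fin 3) ℂ) (t : ℂ) {S : Set ℂ}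
    (hS : ∀ z ∈ S, z ≠ t ∧ z ≠ 0 ∧ z ≠ 1) : DifferentiableOn ℂ (logMatrix B t) S := by
  intro z hz
  obtain ⟨hzt, hz0, hz1⟩ := hS z hz
  refine DifferentiableAt.differentiableWithinAt ?_
  unfold logMatrix
  fun_prop (disch := simpa only [ne_eq, sub_eq_zero])

theorem hasDerivAt_logMatrix_of_schlesinger {B : ℂ → Fin 3 → Matrix (Fin 3) (Fin 3) ℂ}
    {K : Matrix (Fin 3) (Fin 3) ℂ} {t z : ℂ} (ht0 : t ≠ 0) (ht1 : t ≠ 1) (hzt : z ≠ t)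
    (hz0 : z ≠ 0) (hz1 : z ≠ 1) (hB : HasDerivAt B (schlesingerField (B t) K t) t) :
    HasDerivAt (fun s => logMatrix (B s) s z) (deriv (deformationMatrix (B t) K t) z +
      ⁅deformationMatrix (B t) K t z, logMatrix (B t) t z⁆) t := by
  rw [← sub_ne_zero] at ht1 hzt hz1
  have dB := hasDerivAt_pi.1 hB
  have dinv : HasDerivAt (fun s => 1 / (z - s)) (1 / (z - t) ^ 2) t := by
    simpa using ((hasDerivAt_id' t).const_sub z).fun_inv hzt
  refine ((((dB 0).const_smul (1 / z)).add (dinv.smul (dB 1))).add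
    ((dB 2).const_smul (1 / (z - 1)))).congr_deriv ?_
  have hderiv : deriv (deformationMatrix (B t) K t) z = ((z - t) ^ 2)⁻¹ • B t 1 :=
    (hasDerivAt_deformationMatrix (B t) K (sub_ne_zero.1 hzt)).deriv
  rw [hderiv]
  simp only [schlesingerField, deformationMatrix, logMatrix, Ring.lie_def, mul_add, add_mul,
    mul_sub, sub_mul, mul_smul_comm, smul_mul_assoc, smul_add, smul_sub, smul_smul,
    Matrix.cons_val]
  match_scalars <;> field_simp <;> ring

variable {U : Set ℂ} {B : ℂ → Fin 3 → Matrix (Fin 3) (Fin 3) ℂ}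
  {K : ℂ → Matrix (Fin 3) (Fin 3) ℂ} {c t t' : ℂ} {r : ℝ}

theorem gaugeEquivOn_logMatrix_of_schlesinger
    (hU : ∀ t ∈ ball c r, t ≠ 0 ∧ t ≠ 1)
    (hB : ∀ t ∈ ball c r, HasDerivAt B (schlesingerField (B t) (K t) t) t)
    (hK : DifferentiableOn ℂ K (ball c r)) {S : Set ℂ} (hS : IsOpen S)
    (hSr : ∀ z ∈ S, z ∉ ball c r ∧ z ≠ 0 ∧ z ≠ 1) (ht : t ∈ ball c r) (ht' : t' ∈ ball c r) :
    GaugeEquivOn S (logMatrix (B t) t) (logMatrix (B t') t') := by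
  have hne : ∀ z ∈ S, ∀ s ∈ ball c r, z ≠ s := fun z hz s hs => by
    rintro rfl
    exact (hSr z hz).1 hs
  refine gaugeEquivOn_of_zeroCurvature (A := fun z s => logMatrix (B s) s z)
    (Ω := fun z s => deformationMatrix (B s) (K s) s z) hS ?_ (fun z hz s hs => ?_) ht ht'
  · rintro ⟨z, s⟩ ⟨hz, hs⟩
    have dK : DifferentiableAt ℂ (fun p : ℂ × ℂ => K p.2) (z, s) :=
      (hK.differentiableAt (isOpen_ball.mem_nhds hs)).comp (z, s) differentiableAt_snd
    have dB : DifferentiableAt ℂ (fun p : ℂ × ℂ => B p.2 1) (z, s) :=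
      DifferentiableAt.comp (g := fun s => B s 1) (z, s)
        (hasDerivAt_pi.1 (hB s hs) 1).differentiableAt differentiableAt_snd
    have dinv : DifferentiableAt ℂ (fun p : ℂ × ℂ => (p.1 - p.2)⁻¹) (z, s) :=
      (differentiableAt_fst.sub differentiableAt_snd).inv (sub_ne_zero.2 (hne z hz s hs))
    exact (dK.sub (dinv.smul dB)).differentiableWithinAt
  · exact hasDerivAt_logMatrix_of_schlesinger (hU s hs).1 (hU s hs).2 (hne z hz s hs)
      (hSr z hz).2.1 (hSr z hz).2.2 (hB s hs)

theorem isIsomonodromic_of_schlesinger (h0 : (0 : ℂ) ∉ U) (h1 : (1 : ℂ) ∉ U)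
    (hB : ∀ t ∈ U, HasDerivAt B (schlesingerField (B t) (K t) t) t)
    (hK : DifferentiableOn ℂ K U) : IsIsomonodromic U B := by
  intro c r hrU t ht t' ht' z₀
  by_cases hz₀ : z₀ ∉ ball c r ∧ z₀ ≠ 0 ∧ z₀ ≠ 1
  · -- A smaller disc, so that loops avoiding the given one run in an open set of regular points.
    obtain ⟨ρ, hρ, hρr⟩ := exists_between (max_lt (mem_ball.1 ht) (mem_ball.1 ht'))
    rw [max_lt_iff] at hρ
    have hρU : ball c ρ ⊆ U := (ball_subset_ball hρr.le).trans hrU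
    let S : Set ℂ := (closedBall c ρ)ᶜ ∩ ({0}ᶜ ∩ {1}ᶜ)
    have hS : IsOpen S := isClosed_closedBall.isOpen_compl.inter (isOpen_ne.inter isOpen_ne)
    have hSρ : ∀ z ∈ S, z ∉ ball c ρ ∧ z ≠ 0 ∧ z ≠ 1 := fun z hz =>
      ⟨fun h => hz.1 (ball_subset_closedBall h), hz.2⟩
    have hrS : ∀ z, z ∉ ball c r ∧ z ≠ 0 ∧ z ≠ 1 → z ∈ S := fun z hz =>
      ⟨fun h => hz.1 (closedBall_subset_ball hρr h), hz.2⟩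
    obtain ⟨C, hC⟩ := gaugeEquivOn_logMatrix_of_schlesinger
      (fun s hs => ⟨fun h => h0 (h ▸ hρU hs), fun h => h1 (h ▸ hρU hs)⟩)
      (fun s hs => hB s (hρU hs)) (hK.mono hρU) hS hSρ hρ.1 hρ.2
    obtain ⟨u, hu⟩ := (hC z₀ (hrS z₀ hz₀)).1
    exact ⟨u, fun γ hγ => isMonodromy_conj hS (differentiableOn_logMatrix (B t) t fun z hz =>
      ⟨fun h => (hSρ z hz).1 (h ▸ hρ.1), (hSρ z hz).2⟩) (fun s => hrS _ (hγ s))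
      (fun z hz => (hC z hz).2) hu⟩
  · exact ⟨1, fun γ hγ => absurd (γ.source ▸ hγ 0) hz₀⟩

end Schlesinger

section Hamiltonian

/-- The Hamiltonian `H` of the sixth Painlevé equation with parameters `θ`, in canonical
coordinates `(y, x)`. Junk value `0` at `t = 0` and `t = 1`. -/
noncomputable def pviHamiltonian (θ : Fin 4 → ℂ) (t x y : ℂ) : ℂ :=
  (y * (y - 1) * (y - t) * x ^ 2
    + (θ 0 * (y - 1) * (y - t) + (1 + θ 1) * y * (y - 1) + θ 2 * y * (y - t)) * x
    + (θ 0 + θ 1 + θ 2 + θ 3) * (θ 0 + θ 1 + θ 2 - θ 3 + 2) / 4 * y) / (t * (t - 1))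

theorem deriv_pviHamiltonian_left (θ : Fin 4 → ℂ) (t x y : ℂ) :
    deriv (fun x => pviHamiltonian θ t x y) x =
      (2 * y * (y - 1) * (y - t) * x + θ 0 * (y - 1) * (y - t) + (1 + θ 1) * y * (y - 1)
        + θ 2 * y * (y - t)) / (t * (t - 1)) := by
  have hx := hasDerivAt_id' x
  refine (((((hx.pow 2).const_mul _).add (hx.const_mul _)).add_const _).div_const _).deriv.trans ?_
  ring

theorem deriv_pviHamiltonian_right (θ : Fin 4 → ℂ) (t x y : ℂ) :
    deriv (fun y => pviHamiltonian θ t x y) y =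
      ((3 * y ^ 2 - 2 * (1 + t) * y + t) * x ^ 2
        + (θ 0 * (2 * y - 1 - t) + (1 + θ 1) * (2 * y - 1) + θ 2 * (2 * y - t)) * x
        + (θ 0 + θ 1 + θ 2 + θ 3) * (θ 0 + θ 1 + θ 2 - θ 3 + 2) / 4) / (t * (t - 1)) := by
  have hy := hasDerivAt_id' y
  have h1 := hy.sub_const 1
  have ht := hy.sub_const t
  refine ((((((hy.mul h1).mul ht).mul_const _).add ((((h1.const_mul _).mul ht).add
    ((hy.const_mul _).mul h1)).add ((hy.const_mul _).mul ht) |>.mul_const _)).add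
    (hy.const_mul _)).div_const _).deriv.trans ?_
  simp only [Pi.mul_apply]
  ring

theorem deriv_eq_deriv_pviHamiltonian (θ : Fin 4 → ℂ) (y : ℂ → ℂ) {t : ℂ} (ht0 : t ≠ 0)
    (ht1 : t ≠ 1) (hy0 : y t ≠ 0) (hy1 : y t ≠ 1) (hyt : y t ≠ t) :
    deriv y t = deriv (fun x => pviHamiltonian θ t x (y t)) (xOf θ y t) := by
  rw [← sub_ne_zero] at ht1 hy1 hyt
  rw [deriv_pviHamiltonian_left, xOf]
  field_simp
  ring

variable {θ : Fin 4 → ℂ} {U : Set ℂ} {y : ℂ → ℂ} {t : ℂ}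

theorem hasDerivAt_xOf (hU : IsOpen U) (hy : SolvesPVI θ U y) (ht : t ∈ U) (ht0 : t ≠ 0)
    (ht1 : t ≠ 1) : HasDerivAt (xOf θ y) (-deriv (pviHamiltonian θ t (xOf θ y t)) (y t)) t := by
  obtain ⟨hdiff, hy⟩ := hy
  obtain ⟨hy0, hy1, hyt, hpvi⟩ := hy t ht
  rw [← sub_ne_zero] at ht1 hy1 hyt
  have dy : HasDerivAt y (deriv y t) t := (hdiff.differentiableAt (hU.mem_nhds ht)).hasDerivAt
  have ddy : HasDerivAt (deriv y) (deriv (deriv y) t) t :=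
    ((hdiff.deriv hU).differentiableAt (hU.mem_nhds ht)).hasDerivAt
  have did := hasDerivAt_id' t
  have main := ((((((did.sub_const 1).mul ddy).sub_const (θ 0)).div dy hy0).add
    (((ddy.sub_const 1).sub_const (θ 1)).div (dy.sub did) hyt)).sub
    (((did.mul ddy).add_const (θ 2)).div (dy.sub_const 1) hy1)).const_mul (1 / 2)
  refine HasDerivAt.congr_deriv (f := xOf θ y) main ?_
  rw [hpvi, deriv_pviHamiltonian_right]
  simp only [xOf, Pi.mul_apply, Pi.sub_apply]
  field_simp
  ring

theorem hasDerivAt_of_solvesPVI (hU : IsOpen U) (hy : SolvesPVI θ U y) (ht : t ∈ U) (ht0 : t ≠ 0)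
    (ht1 : t ≠ 1) :
    HasDerivAt y (deriv (fun x => pviHamiltonian θ t x (y t)) (xOf θ y t)) t := by
  obtain ⟨hy0, hy1, hyt, -⟩ := hy.2 t ht
  rw [← deriv_eq_deriv_pviHamiltonian θ y ht0 ht1 hy0 hy1 hyt]
  exact (hy.1.differentiableAt (hU.mem_nhds ht)).hasDerivAt

end Hamiltonian

section RowPart

variable {n 𝕜 : Type*} [DecidableEq n]

/-- The matrix obtained from `b` by keeping the `i`-th row and annihilating the others. -/
def rowPart [MulZeroOneClass 𝕜] (b : Matrix n n 𝕜) (i : n) : Matrix n n 𝕜 :=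
  Matrix.vecMulVec (Pi.single i 1) (b i)

variable [Fintype n]

theorem sum_rowPart [NonAssocSemiring 𝕜] (b : Matrix n n 𝕜) : ∑ i, rowPart b i = b := by
  ext j k
  simp [rowPart, Matrix.sum_apply, Matrix.vecMulVec_apply, Pi.single_apply]

theorem trace_rowPart [NonAssocSemiring 𝕜] (b : Matrix n n 𝕜) (i : n) :
    (rowPart b i).trace = b i i := by
  simp [rowPart, Matrix.trace_vecMulVec]

theorem rank_rowPart_le_one [CommRing 𝕜] [StrongRankCondition 𝕜] (b : Matrix n n 𝕜) (i : n) :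
    (rowPart b i).rank ≤ 1 :=
  Matrix.rank_vecMulVec_le _ _

theorem rank_rowPart_eq_one [Field 𝕜] {b : Matrix n n 𝕜} {i : n} (h : b i ≠ 0) :
    (rowPart b i).rank = 1 := by
  refine le_antisymm (rank_rowPart_le_one b i) (Nat.one_le_iff_ne_zero.2 fun hrank => h ?_)
  have hzero : (rowPart b i).mulVecLin = 0 :=
    LinearMap.range_eq_bot.1 (Submodule.finrank_eq_zero.1 hrank)
  exact funext fun k => by
    simpa [rowPart, Matrix.vecMulVec_apply] using
      congrFun (LinearMap.congr_fun hzero (Pi.single k 1)) i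

end RowPart

section Residues

open scoped Matrix.Norms.Operator

/-- The matrix `B₁ + B₂ + B₃`, from which each residue takes one row. -/
noncomputable def residueSum (lam mu : Fin 3 → ℂ) (x y t : ℂ) : Matrix (Fin 3) (Fin 3) ℂ :=
  ∑ i, residues lam mu x y t i

/-- The gauge `K` in which the Schlesinger equations preserve the shape of residues that are the
rows of `b`. Its off-diagonal entries achieve this, and its diagonal is then determined by
`ℓ K = -ℓ'` for `ℓ = (1, 1, t)`, which is a left eigenvector of `residueSum`. -/
noncomputable def rowGauge (b : Matrix (Fin 3) (Fin 3) ℂ) (t : ℂ) : Matrix (Fin 3) (Fin 3) ℂ :=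
  !![b 1 0 / t, -b 0 1 / t, 0;
    -b 1 0 / t, b 0 1 / t + t * b 2 1 / (t - 1), -b 1 2 / (t - 1);
    0, -b 2 1 / (t - 1), (b 1 2 / (t - 1) - 1) / t]

theorem lie_matrix_apply {n R : Type*} [Fintype n] [NonUnitalNonAssocRing R] (A B : Matrix n n R)
    (i j : n) : ⁅A, B⁆ i j = ∑ k, A i k * B k j - ∑ k, B i k * A k j :=
  rfl

theorem schlesingerField_rowPart (b : Matrix (Fin 3) (Fin 3) ℂ) (t : ℂ) :
    schlesingerField (rowPart b) (rowGauge b t) t = rowPart ⁅rowGauge b t, b⁆ := by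
  ext i j k
  fin_cases i <;> fin_cases j <;> fin_cases k <;>
    simp only [schlesingerField, rowGauge, lie_matrix_apply, rowPart, Matrix.vecMulVec_apply,
      Pi.single_apply, Fin.sum_univ_three, Matrix.add_apply, Matrix.smul_apply, smul_eq_mul,
      Fin.zero_eta, Fin.mk_one, Fin.reduceFinMk, Fin.reduceEq, if_true, if_false, Matrix.of_apply,
      Matrix.cons_val] <;>
    ring

theorem residueSum_eq (lam mu : Fin 3 → ℂ) (x y t : ℂ) : residueSum lam mu x y t =
    let b := residues lam mu x y t
    !![lam 0, b 0 0 1, b 0 0 2; b 1 1 0, lam 1, b 1 1 2; b 2 2 0, b 2 2 1, lam 2] := by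
  ext i j
  fin_cases i <;> fin_cases j <;> simp [residueSum, residues, Fin.sum_univ_three]

theorem residues_eq_rowPart (lam mu : Fin 3 → ℂ) (x y t : ℂ) :
    residues lam mu x y t = rowPart (residueSum lam mu x y t) := by
  ext i j k
  rw [residueSum_eq]
  fin_cases i <;> fin_cases j <;> fin_cases k <;> simp [residues, rowPart, Matrix.vecMulVec_apply]

theorem residueSum_apply_self (lam mu : Fin 3 → ℂ) (x y t : ℂ) (i : Fin 3) :
    residueSum lam mu x y t i i = lam i := by
  rw [residueSum_eq]
  fin_cases i <;> rfl

theorem charpoly_residueSum {lam mu : Fin 3 → ℂ} (hsum : ∑ i, lam i = ∑ i, mu i) {x y t : ℂ}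
    (ht0 : t ≠ 0) (ht1 : t ≠ 1) :
    (residueSum lam mu x y t).charpoly = ∏ i, (Polynomial.X - Polynomial.C (mu i)) := by
  rw [← sub_ne_zero] at ht1
  simp only [Fin.sum_univ_three] at hsum
  have hlam : lam 2 = mu 0 + mu 1 + mu 2 - lam 0 - lam 1 := by linear_combination hsum
  refine Polynomial.funext fun z => ?_
  rw [Matrix.eval_charpoly, Matrix.det_fin_three, Fin.prod_univ_three, residueSum_eq]
  simp only [residues, hlam, Matrix.scalar_apply, Matrix.sub_apply, Matrix.diagonal_apply,
    Fin.reduceEq, if_true, if_false, Matrix.of_apply, Matrix.cons_val, Polynomial.eval_mul,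
    Polynomial.eval_sub, Polynomial.eval_X, Polynomial.eval_C]
  field_simp
  ring

theorem mu_two_eq_zero_of_residueSum_zero {lam mu : Fin 3 → ℂ} {x y t : ℂ} (ht1 : t ≠ 1)
    (hy0 : y ≠ 0) (h : residueSum lam mu x y t 0 = 0) : mu 2 = 0 := by
  have h0 := congrFun h 0
  have h1 := congrFun h 1
  have h2 := congrFun h 2
  simp only [residueSum_eq, residues, Matrix.of_apply, Matrix.cons_val, Pi.zero_apply] at h0 h1 h2
  have hx : mu 0 - x * y = 0 := (mul_eq_zero.1 (show (mu 0 - x * y) * (t - 1) = 0 by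
    linear_combination h1 - h2 + (t - 1) * h0)).resolve_right (sub_ne_zero.2 ht1)
  exact (mul_eq_zero.1 (show mu 2 * y = 0 by
    linear_combination (y - 1) * hx - h1 + h0)).resolve_right hy0

theorem mu_two_eq_zero_of_residueSum_one {lam mu : Fin 3 → ℂ} (hsum : ∑ i, lam i = ∑ i, mu i)
    {x y t : ℂ} (ht1 : t ≠ 1) (hyt : y ≠ t) (h : residueSum lam mu x y t 1 = 0) :
    mu 2 = 0 := by
  rw [← sub_ne_zero] at ht1 hyt
  simp only [Fin.sum_univ_three] at hsum
  have h0 := congrFun h 0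
  have h1 := congrFun h 1
  have h2 := congrFun h 2
  simp only [residueSum_eq, residues, Matrix.of_apply, Matrix.cons_val, Pi.zero_apply] at h0 h1 h2
  rw [h1, zero_add, div_eq_zero_iff, or_iff_left ht1] at h0
  have hx : x * (y - t) - mu 0 = 0 := by linear_combination h2 - h0 + t * hsum - t * h1
  exact (mul_eq_zero.1 (show mu 2 * (y - t) = 0 by
    linear_combination h0 - (y - 1) * hx)).resolve_right hyt

theorem mu_two_eq_zero_of_residueSum_two {lam mu : Fin 3 → ℂ} (hsum : ∑ i, lam i = ∑ i, mu i)
    {x y t : ℂ} (ht0 : t ≠ 0) (ht1 : t ≠ 1) (hy1 : y ≠ 1) (h : residueSum lam mu x y t 2 = 0) :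
    mu 2 = 0 := by
  rw [← sub_ne_zero] at ht1 hy1
  simp only [Fin.sum_univ_three] at hsum
  have h0 := congrFun h 0
  have h1 := congrFun h 1
  have h2 := congrFun h 2
  simp only [residueSum_eq, residues, Matrix.of_apply, Matrix.cons_val, Pi.zero_apply] at h0 h1 h2
  rw [div_eq_zero_iff, or_iff_left ht0] at h0 h1
  field_simp at h0
  have hx : mu 0 - x * (y - 1) = 0 := (mul_eq_zero.1 (show (mu 0 - x * (y - 1)) * t = 0 by
    linear_combination t * h2 - t * hsum - h0 - h1)).resolve_right ht0
  exact (mul_eq_zero.1 (show mu 2 * (y - 1) = 0 by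
    linear_combination h1 + y * hx + hsum - h2)).resolve_right hy1

theorem residueSum_row_ne_zero {lam mu : Fin 3 → ℂ} (hsum : ∑ i, lam i = ∑ i, mu i)
    {x y t : ℂ} (ht0 : t ≠ 0) (ht1 : t ≠ 1) (hy0 : y ≠ 0) (hy1 : y ≠ 1) (hyt : y ≠ t)
    {i : Fin 3} (hi : lam i ≠ 0 ∨ mu 2 ≠ 0) : residueSum lam mu x y t i ≠ 0 := by
  intro hzero
  have hlam : lam i = 0 := by rw [← residueSum_apply_self lam mu x y t i, hzero, Pi.zero_apply]
  have hmu : mu 2 = 0 := by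
    fin_cases i
    · exact mu_two_eq_zero_of_residueSum_zero ht1 hy0 hzero
    · exact mu_two_eq_zero_of_residueSum_one hsum ht1 hyt hzero
    · exact mu_two_eq_zero_of_residueSum_two hsum ht0 ht1 hy1 hzero
  exact hi.elim (· hlam) (· hmu)

end Residues

section Deformation

open scoped Matrix.Norms.Operator

variable {lam mu : Fin 3 → ℂ}

/-- The derivative of `residueSum` along a curve `(x, y, t)` with velocity `(x', y', 1)`. -/
noncomputable def residueSumDeriv (lam mu : Fin 3 → ℂ) (x y t x' y' : ℂ) :
    Matrix (Fin 3) (Fin 3) ℂ :=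
  let b := residueSum lam mu x y t
  let d₁₂ := (mu 0 - x * y) * y' - mu 2 * y' - (x' * y + x * y') * (y - 1)
  let d₁₃ := lam 0 + (mu 0 - x * y) * (y' - 1) - mu 2 * y' - (x' * y + x * y') * (y - t)
  let d₂₁ := (mu 2 * (y' - 1) - mu 0 * y' + x' * (y - t) * (y - 1) + x * (y' - 1) * (y - 1)
    + x * (y - t) * y' - (b 1 0 - lam 1)) / (t - 1)
  !![0, d₁₂, d₁₃; d₂₁, 0, mu 1 - lam 2 - d₁₃; -(d₂₁ + b 2 0) / t, -(d₁₂ + b 2 1) / t, 0]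

theorem hasDerivAt_residueSum {x y : ℂ → ℂ} {t x' y' : ℂ} (ht0 : t ≠ 0) (ht1 : t ≠ 1)
    (hx : HasDerivAt x x' t) (hy : HasDerivAt y y' t) :
    HasDerivAt (fun s => residueSum lam mu (x s) (y s) s)
      (residueSumDeriv lam mu (x t) (y t) t x' y') t := by
  rw [← sub_ne_zero] at ht1
  have ht := hasDerivAt_id' t
  have h₁₂ := ((hy.const_mul (mu 2)).const_sub (lam 0)).add
    (((hx.mul hy).const_sub (mu 0)).mul (hy.sub_const 1))
  have h₁₃ := ((ht.const_mul (lam 0)).sub (hy.const_mul (mu 2))).add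
    (((hx.mul hy).const_sub (mu 0)).mul (hy.sub ht))
  have h₂₁ := (((((hy.sub ht).const_mul (mu 2)).sub ((hy.sub_const 1).const_mul (mu 0))).add
    ((hx.mul (hy.sub ht)).mul (hy.sub_const 1))).div (ht.sub_const 1) ht1).const_add (lam 1)
  have h₃₂ := (h₁₂.const_sub (mu 1 - lam 1)).div ht ht0
  have h₂₃ := (ht.const_mul (mu 1 - lam 2)).sub h₁₃
  have h₃₁ := (h₂₁.const_sub (mu 1 - lam 0)).div ht ht0
  simp only [residueSum_eq]
  refine hasDerivAt_matrix_iff.2 fun j k => ?_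
  fin_cases j <;> fin_cases k <;>
    [exact hasDerivAt_const t (lam 0); refine h₁₂.congr_deriv ?_; refine h₁₃.congr_deriv ?_;
      refine h₂₁.congr_deriv ?_; exact hasDerivAt_const t (lam 1); refine h₂₃.congr_deriv ?_;
      refine h₃₁.congr_deriv ?_; refine h₃₂.congr_deriv ?_; exact hasDerivAt_const t (lam 2)] <;>
    simp only [residueSumDeriv, residueSum_eq, residues, Fin.zero_eta, Fin.mk_one,
      Fin.reduceFinMk, Matrix.of_apply, Matrix.cons_val, Pi.mul_apply, Pi.add_apply,
      Pi.sub_apply, Pi.div_apply] <;>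
    field_simp <;>
    ring

theorem residueSumDeriv_pviHamiltonian (hsum : ∑ i, lam i = ∑ i, mu i) (x y : ℂ) {t : ℂ}
    (ht0 : t ≠ 0) (ht1 : t ≠ 1) :
    residueSumDeriv lam mu x y t
        (-deriv (fun y => pviHamiltonian (pviParam lam mu) t x y) y)
        (deriv (fun x => pviHamiltonian (pviParam lam mu) t x y) x) =
      ⁅rowGauge (residueSum lam mu x y t) t, residueSum lam mu x y t⁆ := by
  rw [← sub_ne_zero] at ht1
  simp only [Fin.sum_univ_three] at hsum
  have hlam : lam 2 = mu 0 + mu 1 + mu 2 - lam 0 - lam 1 := by linear_combination hsum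
  rw [deriv_pviHamiltonian_right, deriv_pviHamiltonian_left]
  ext j k
  fin_cases j <;> fin_cases k <;>
    simp only [residueSumDeriv, lie_matrix_apply, Fin.sum_univ_three, rowGauge, residueSum_eq,
      residues, pviParam, hlam, Fin.zero_eta, Fin.mk_one, Fin.reduceFinMk, Matrix.of_apply,
      Matrix.cons_val] <;>
    field_simp <;>
    ring

variable {U : Set ℂ} {y : ℂ → ℂ}

theorem hasDerivAt_residueSum_of_solvesPVI (hsum : ∑ i, lam i = ∑ i, mu i) (hU : IsOpen U)
    (hy : SolvesPVI (pviParam lam mu) U y) {t : ℂ} (ht : t ∈ U) (ht0 : t ≠ 0) (ht1 : t ≠ 1) :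
    let b := fun s => residueSum lam mu (xOf (pviParam lam mu) y s) (y s) s
    HasDerivAt b ⁅rowGauge (b t) t, b t⁆ t := by
  intro b
  rw [← residueSumDeriv_pviHamiltonian hsum _ _ ht0 ht1]
  exact hasDerivAt_residueSum ht0 ht1 (hasDerivAt_xOf hU hy ht ht0 ht1)
    (hasDerivAt_of_solvesPVI hU hy ht ht0 ht1)

theorem hasDerivAt_rowPart {n : Type*} [Finite n] [DecidableEq n] {b : ℂ → Matrix n n ℂ}
    {b' : Matrix n n ℂ} {t : ℂ} (hb : HasDerivAt b b' t) :
    HasDerivAt (fun s => rowPart (b s)) (rowPart b') t := by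
  cases nonempty_fintype n
  refine hasDerivAt_pi.2 fun i => hasDerivAt_matrix_iff.2 fun j k => ?_
  simp only [rowPart, Matrix.vecMulVec_apply]
  exact (hasDerivAt_matrix_iff.1 hb i k).const_mul _

theorem differentiableAt_rowGauge {b : ℂ → Matrix (Fin 3) (Fin 3) ℂ} {t : ℂ} (ht0 : t ≠ 0)
    (ht1 : t ≠ 1) (hb : DifferentiableAt ℂ b t) :
    DifferentiableAt ℂ (fun s => rowGauge (b s) s) t := by
  rw [← sub_ne_zero] at ht1
  have hentry (j k : Fin 3) : DifferentiableAt ℂ (fun s => b s j k) t :=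
    (hasDerivAt_matrix_iff.1 hb.hasDerivAt j k).differentiableAt
  refine differentiableAt_pi.2 fun j => differentiableAt_pi.2 fun k => ?_
  fin_cases j <;> fin_cases k <;>
    simp only [rowGauge, Fin.zero_eta, Fin.mk_one, Fin.reduceFinMk, Matrix.of_apply,
      Matrix.cons_val] <;>
    fun_prop (disch := assumption)

theorem isIsomonodromic_residueFamily (hsum : ∑ i, lam i = ∑ i, mu i) (hU : IsOpen U)
    (h0 : (0 : ℂ) ∉ U) (h1 : (1 : ℂ) ∉ U) (hy : SolvesPVI (pviParam lam mu) U y) :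
    IsIsomonodromic U (residueFamily lam mu y) := by
  let b := fun s => residueSum lam mu (xOf (pviParam lam mu) y s) (y s) s
  have hU0 : ∀ t ∈ U, t ≠ 0 := fun _ ht => ne_of_mem_of_not_mem ht h0
  have hU1 : ∀ t ∈ U, t ≠ 1 := fun _ ht => ne_of_mem_of_not_mem ht h1
  have hb : ∀ t ∈ U, HasDerivAt b ⁅rowGauge (b t) t, b t⁆ t := fun t ht =>
    hasDerivAt_residueSum_of_solvesPVI hsum hU hy ht (hU0 t ht) (hU1 t ht)
  have hrow : residueFamily lam mu y = fun s => rowPart (b s) :=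
    funext fun s => residues_eq_rowPart lam mu _ _ s
  rw [hrow]
  refine isIsomonodromic_of_schlesinger (K := fun s => rowGauge (b s) s) h0 h1
    (fun t ht => ?_) fun t ht => ?_
  · rw [schlesingerField_rowPart]
    exact hasDerivAt_rowPart (hb t ht)
  · exact (differentiableAt_rowGauge (hU0 t ht) (hU1 t ht)
      (hb t ht).differentiableAt).differentiableWithinAt

end Deformation

theorem theorem2 (lam mu : Fin 3 → ℂ) (hsum : ∑ i, lam i = ∑ i, mu i)
    (U : Set ℂ) (hU : IsOpen U) (h0 : (0 : ℂ) ∉ U) (h1 : (1 : ℂ) ∉ U)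
    (y : ℂ → ℂ) (hy : SolvesPVI (pviParam lam mu) U y) :
    (∀ t ∈ U,
      (∀ i, (residueFamily lam mu y t i).rank ≤ 1 ∧
        (lam i ≠ 0 ∨ mu 2 ≠ 0 → (residueFamily lam mu y t i).rank = 1) ∧
        (residueFamily lam mu y t i).trace = lam i) ∧
      (∑ i, residueFamily lam mu y t i).charpoly =
        ∏ i, (Polynomial.X - Polynomial.C (mu i))) ∧
    IsIsomonodromic U (residueFamily lam mu y) := by
  refine ⟨fun t ht => ?_, isIsomonodromic_residueFamily hsum hU h0 h1 hy⟩
  obtain ⟨hy0, hy1, hyt, -⟩ := hy.2 t ht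
  have ht0 : t ≠ 0 := ne_of_mem_of_not_mem ht h0
  have ht1 : t ≠ 1 := ne_of_mem_of_not_mem ht h1
  simp only [residueFamily, residues_eq_rowPart, sum_rowPart]
  exact ⟨fun i => ⟨rank_rowPart_le_one _ i,
    fun hi => rank_rowPart_eq_one (residueSum_row_ne_zero hsum ht0 ht1 hy0 hy1 hyt hi),
    (trace_rowPart _ i).trans (residueSum_apply_self ..)⟩, charpoly_residueSum hsum ht0 ht1⟩
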